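/- Let $k$ be a countable Hilbertian field of characteristic $0$, and fix an algebraic closure $\bar k$ of $k$; all algebraic extensions below are taken inside $\bar k$. Here a field $K$ of characteristic $0$ is called Hilbertian if for every irreducible polynomial $f(T,X)\in K[T,X]$ of degree at least $1$ in $X$ there are infinitely many $t\in K$ such that $f(t,X)$ is irreducible in $K[X]$. Two extensions $M/K$ and $N/K$ are called disjoint over $K$ if $M\cap N=K$. An algebraic extension $L/K$ is called vast if $L\neq K$ and for every finite extension $N/K$ there is a field $M$ with $K\subsetneq M\subseteq L$ such that $M$ and $N$ are disjoint over $K$. The degree $[L:K]$ of an algebraic extension is the supernatural number given by the least common multiple of the degrees of the finite subextensions of $L/K$. Let $\mathcal A$ be a countable set of vast extensions $L/K$ such that $K$ is a finite extension of $k$ for every $L/K\in\mathcal A$. Then there exists an algebraic extension $F/k$ such that $F$ is Hilbertian and: 1. $[F:k]$ divides $\prod_{L/K\in\mathcal A}[L:K]$ as supernatural numbers; 2. for every finite subextension $K/k$ of $F/k$ and every extension $L/K$ in $\mathcal A$, the extensions $F/K$ and $L/K$ are not disjoint over $K$, i.e. $F\cap L\neq K$. -/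

import Mathlib

/-- A supernatural number `∏ p ^ n_p`, given by its exponents `n_p ∈ {0, 1, 2, …, ∞}`
at all primes `p`. -/
@[ext]
structure Supernatural where
  exponent : Nat.Primes → ℕ∞

namespace Supernatural

/-- Divisibility of supernatural numbers: comparison of the exponents at every prime. -/
instance : Dvd Supernatural where
  dvd a b := ∀ p, a.exponent p ≤ b.exponent p

/-- The product of an arbitrary family of supernatural numbers. At each prime, the exponents are
added up; the sum of a family in `ℕ∞` is the supremum of its finite partial sums. -/
noncomputable def prod {ι : Type*} (a : ι → Supernatural) : Supernatural where
  exponent p := ⨆ s : Finset ι, ∑ i ∈ s, (a i).exponent p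

end Supernatural

/-- The degree `[L : K]` of an algebraic extension as a supernatural number: the least common
multiple of the degrees `[M : K]` of all finite subextensions `M / K` of `L / K`. -/
noncomputable def supernaturalDegree (K L : Type*) [Field K] [Field L] [Algebra K L] :
    Supernatural where
  exponent p := ⨆ (M : IntermediateField K L) (_ : FiniteDimensional K M),
    (padicValNat p (Module.finrank K M) : ℕ∞)

/-- A field `K` of characteristic zero is Hilbertian if for every irreducible polynomial
`f(T, X) ∈ K[T, X]` of degree at least `1` in `X` there are infinitely many `t ∈ K` such that
`f(t, X) ∈ K[X]` is irreducible. Here `K[T, X]` is `K[T][X]`: the outer variable is `X`. -/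
def IsHilbertian (K : Type*) [Field K] : Prop :=
  ∀ f : Polynomial (Polynomial K), Irreducible f → 1 ≤ f.natDegree →
    {t : K | Irreducible (f.map (Polynomial.evalRingHom t))}.Infinite

/-- Let `Ω` be an algebraically closed field containing `K`, and let `L / K` be an extension
inside `Ω`. It is vast if it is algebraic, `L ≠ K`, and for every finite extension `F / K` there
is a field `K ⊊ M ⊆ L` such that `M` and `F` are disjoint over `K`, i.e. `M ∩ F = K`
(`Disjoint` is taken in the lattice of intermediate fields of `Ω / K`, whose bottom is `K`). -/
def IsVast {K Ω : Type*} [Field K] [Field Ω] [Algebra K Ω] (L : IntermediateField K Ω) : Prop :=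
  Algebra.IsAlgebraic K L ∧ L ≠ ⊥ ∧
    ∀ F : IntermediateField K Ω, FiniteDimensional K F →
      ∃ M : IntermediateField K Ω, M ≠ ⊥ ∧ M ≤ L ∧ Disjoint M F

/-- An extension of fields `L / K` with `k ⊆ K ⊆ L ⊆ Ω`. -/
structure ExtensionInside (k Ω : Type*) [Field k] [Field Ω] [Algebra k Ω] where
  base : IntermediateField k Ω
  top : IntermediateField base Ω

open Polynomial IntermediateField

/-! `F` is the union of a chain of finite extensions `F_n / k`, each carried along with a finite
normal extension `N_n ⊇ F_n`, its hull, subject to `F_m ∩ N_n = F_n` for all `m ≥ n`. Hence `F ∩ N_n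
= F_n`: nothing added later disturbs what the hull sees.

To deal with `L/K` once `K ⊆ F_n`, vastness is applied to the finite extension `N_n`. It gives `a ∈
L \ K` with `K(a)` linearly disjoint from `N_n` over `K`. Passing to `F_n(a)` multiplies the degree
by `[K(a) : K]`, which divides `[L : K]`, and adds nothing inside `N_n`
(`IsVast.exists_sup_extension`). Each `L/K` is used at most once, so the degree of `F` divides the
product.

For Hilbertianity, `F_n` is Hilbertian as a finite extension of `k`
(`IsHilbertian.of_finiteDimensional`), so an irreducible `f` over `F_n` has as many irreducible
specializations as desired. Once their roots lie in the hull, they stay irreducible over `F`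
(`IrreducibleOver.of_le`). There are countably many such requirements, so a generic chain meets them
all. -/

/-! ### Finite extensions of Hilbertian fields -/

theorem exists_irreducible_associated_map {R E : Type*} [CommRing R] [IsDomain R] [IsGCDMonoid R]
    [Field E] [Algebra R E] [IsFractionRing R E] {p : E[X]} (hp : Irreducible p) :
    ∃ h : R[X], Irreducible h ∧ Associated (h.map (algebraMap R E)) p := by
  have : NormalizedGCDMonoid R := Classical.arbitrary _
  obtain ⟨c, c0, hc⟩ := IsLocalization.integerNormalization_spec (nonZeroDivisors R) p
  set q := IsLocalization.integerNormalization (nonZeroDivisors R) p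
  have hq0 : q ≠ 0 := by
    intro h0
    rw [h0, Polynomial.map_zero, eq_comm, smul_eq_zero] at hc
    exact hc.elim (nonZeroDivisors.ne_zero c0) hp.ne_zero
  have hinj := IsFractionRing.injective R E
  have key : Associated (q.primPart.map (algebraMap R E)) p := by
    have h1 : C (algebraMap R E q.content) * q.primPart.map (algebraMap R E)
        = C (algebraMap R E c) * p := by
      rw [← map_C, ← Polynomial.map_mul, ← q.eq_C_content_mul_primPart, hc, Algebra.smul_def,
        Polynomial.algebraMap_apply]
    have hu1 : IsUnit (C (algebraMap R E q.content)) := by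
      rw [isUnit_C, isUnit_iff_ne_zero, Ne, map_eq_zero_iff _ hinj, content_eq_zero_iff]
      exact hq0
    have hu2 : IsUnit (C (algebraMap R E c)) := by
      rw [isUnit_C, isUnit_iff_ne_zero, Ne, map_eq_zero_iff _ hinj]
      exact nonZeroDivisors.ne_zero c0
    exact (associated_unit_mul_left _ _ hu1).symm.trans
      (h1 ▸ associated_unit_mul_left _ _ hu2)
  exact ⟨q.primPart, (q.isPrimitive_primPart.irreducible_iff_irreducible_map_fraction_map
    (K := E)).2 (key.symm.irreducible hp), key⟩

/-- In a finite separable extension, `x + c θ` is primitive for some natural number `c`, as soon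
as `x` and `θ` generate the extension. -/
theorem exists_nat_adjoin_add_eq_top {E W : Type*} [Field E] [CharZero E] [Field W] [Algebra E W]
    [FiniteDimensional E W] (x θ : W) (h : E⟮x, θ⟯ = ⊤) :
    ∃ c : ℕ, E⟮x + c * θ⟯ = ⊤ := by
  have : Finite (IntermediateField E W) :=
    (Field.exists_primitive_element_iff_finite_intermediateField E W).1
      ⟨inferInstance, Field.exists_primitive_element E W⟩
  -- Only finitely many intermediate fields exist, so two values of `c` give the same one; it
  -- contains the difference, a nonzero multiple of `θ`.
  obtain ⟨c, d, hcd, heq⟩ := Finite.exists_ne_map_eq_of_infinite fun c : ℕ ↦ E⟮x + c * θ⟯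
  refine ⟨c, top_le_iff.1 (h ▸ ?_)⟩
  have hc : x + c * θ ∈ E⟮x + c * θ⟯ := mem_adjoin_simple_self E _
  have hd : x + d * θ ∈ E⟮x + c * θ⟯ := by
    have := mem_adjoin_simple_self E (x + d * θ)
    rwa [← show E⟮x + c * θ⟯ = E⟮x + d * θ⟯ from heq] at this
  have hθ : θ ∈ E⟮x + c * θ⟯ := by
    have : CharZero W := charZero_of_injective_algebraMap (algebraMap E W).injective
    have h1 := sub_mem hc hd
    have h2 : ((c : W) - d) ≠ 0 := sub_ne_zero.2 (by exact_mod_cast hcd)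
    have h3 : ((c : W) - d)⁻¹ * ((x + c * θ) - (x + d * θ)) = θ := by
      field_simp; ring
    have hmem := mul_mem (inv_mem (sub_mem (IntermediateField.natCast_mem E⟮x + c * θ⟯ c)
      (IntermediateField.natCast_mem _ d))) h1
    rwa [h3] at hmem
  have hx : x ∈ E⟮x + c * θ⟯ := by
    simpa using sub_mem hc (mul_mem (IntermediateField.natCast_mem _ c) hθ)
  rw [adjoin_le_iff]
  rintro y (rfl | rfl)
  exacts [hx, hθ]

/-- Adjoin a root `x` of `f` to `E'`. For suitable `c`, the element `x + c θ` generates the whole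
tower over `E`, and `h` is its minimal polynomial cleared of denominators. Since `h(X + c θ)`
vanishes at `x`, Gauss's lemma yields the divisibility. The exact degree of `h` is what later
transfers irreducibility from `h` to `f`. -/
theorem exists_irreducible_dvd_taylor {R S E E' : Type*} [CommRing R] [IsDomain R]
    [IsGCDMonoid R] [CommRing S] [IsDomain S] [IsGCDMonoid S] [Algebra R S]
    [Field E] [CharZero E] [Algebra R E] [IsFractionRing R E]
    [Field E'] [Algebra S E'] [IsFractionRing S E'] [Algebra E E'] [Algebra R E']
    [IsScalarTower R E E'] [IsScalarTower R S E'] [FiniteDimensional E E']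
    (θ : S) (hθ : E⟮algebraMap S E' θ⟯ = ⊤)
    (f : S[X]) (hf : Irreducible f) (hdeg : 1 ≤ f.natDegree) :
    ∃ (c : ℕ) (h : R[X]), Irreducible h ∧ h.natDegree = Module.finrank E E' * f.natDegree ∧
      f ∣ taylor (c * θ) (h.map (algebraMap R S)) := by
  have hprim := hf.isPrimitive (by omega)
  have hfE : Irreducible (f.map (algebraMap S E')) :=
    (hprim.irreducible_iff_irreducible_map_fraction_map).1 hf
  have : Fact (Irreducible (f.map (algebraMap S E'))) := ⟨hfE⟩
  let W := AdjoinRoot (f.map (algebraMap S E'))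
  have : FiniteDimensional E' W := (AdjoinRoot.powerBasis hfE.ne_zero).finite
  have : FiniteDimensional E W := FiniteDimensional.trans E E' W
  let x : W := AdjoinRoot.root _
  let θ' : W := algebraMap E' W (algebraMap S E' θ)
  have htop : E⟮x, θ'⟯ = ⊤ := by
    have h1 : ∀ e : E', algebraMap E' W e ∈ E⟮x, θ'⟯ := by
      have : (⊤ : IntermediateField E E').map (IsScalarTower.toAlgHom E E' W) ≤ E⟮x, θ'⟯ := by
        rw [← hθ, adjoin_map, adjoin_le_iff]
        rintro _ ⟨_, rfl, rfl⟩
        exact subset_adjoin _ _ (by simp [θ'])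
      intro e
      exact this ⟨e, trivial, rfl⟩
    rw [eq_top_iff]
    rintro y -
    induction y using AdjoinRoot.induction_on with | ih p => ?_
    rw [← AdjoinRoot.aeval_eq, aeval_eq_sum_range]
    refine sum_mem fun i _ ↦ ?_
    rw [Algebra.smul_def]
    exact mul_mem (h1 _) (pow_mem (subset_adjoin _ _ (by simp [x])) _)
  obtain ⟨c, hc⟩ := exists_nat_adjoin_add_eq_top x θ' htop
  have hint : IsIntegral E (x + c * θ') := IsIntegral.of_finite E _
  obtain ⟨h, hirr, hass⟩ := exists_irreducible_associated_map (R := R) (minpoly.irreducible hint)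
  refine ⟨c, h, hirr, ?_, ?_⟩
  · have h1 : h.natDegree = (minpoly E (x + c * θ')).natDegree := by
      rw [← natDegree_map_eq_of_injective (IsFractionRing.injective R E)]
      exact natDegree_eq_of_degree_eq (degree_eq_degree_of_associated hass)
    rw [h1, ← adjoin.finrank hint, hc, finrank_top', ← Module.finrank_mul_finrank E E' W,
      (AdjoinRoot.powerBasis hfE.ne_zero).finrank, AdjoinRoot.powerBasis_dim,
      natDegree_map_eq_of_injective (IsFractionRing.injective S E')]
  · refine hprim.dvd_of_fraction_map_dvd_fraction_map (K := E') ?_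
    rw [← AdjoinRoot.mk_eq_zero, ← AdjoinRoot.aeval_eq]
    have h0 : aeval (x + c * θ') (h.map (algebraMap R E)) = 0 :=
      (minpoly.dvd_iff.1 hass.symm.dvd)
    rw [aeval_def, eval₂_map] at h0
    rw [aeval_def, eval₂_map, taylor_apply, eval₂_comp, eval₂_map, ← h0]
    congr 1
    · rw [RingHom.comp_assoc, ← IsScalarTower.algebraMap_eq R S E', IsScalarTower.algebraMap_eq R E E',
        ← RingHom.comp_assoc, ← IsScalarTower.algebraMap_eq]
    · rw [eval₂_add, eval₂_X, eval₂_C, map_mul, map_natCast]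
      rfl

/-- A root of an irreducible factor `b` of `a` has degree `deg h` over `K`, but at most `[L : K] *
deg b`. -/
theorem finrank_le_natDegree_of_dvd_map {K L : Type*} [Field K] [Field L] [Algebra K L]
    [FiniteDimensional K L] {h : K[X]} (hh : Irreducible h) {d : ℕ}
    (hd : h.natDegree = Module.finrank K L * d) {a : L[X]} (ha : ¬ IsUnit a)
    (hdvd : a ∣ h.map (algebraMap K L)) : d ≤ a.natDegree := by
  have hh0 : h.map (algebraMap K L) ≠ 0 := by
    rw [Ne, Polynomial.map_eq_zero]; exact hh.ne_zero
  have ha0 : a ≠ 0 := ne_zero_of_dvd_ne_zero hh0 hdvd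
  obtain ⟨b, hb, hba⟩ := WfDvdMonoid.exists_irreducible_factor ha ha0
  refine le_trans ?_ (natDegree_le_of_dvd hba ha0)
  have : Fact (Irreducible b) := ⟨hb⟩
  have : FiniteDimensional L (AdjoinRoot b) := (AdjoinRoot.powerBasis hb.ne_zero).finite
  have : FiniteDimensional K (AdjoinRoot b) := FiniteDimensional.trans K L _
  have hroot : aeval (AdjoinRoot.root b) h = 0 := by
    have := (AdjoinRoot.mk_eq_zero (f := b)).2 (hba.trans hdvd)
    rwa [← AdjoinRoot.aeval_eq, aeval_map_algebraMap] at this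
  have h1 : h.natDegree = (minpoly K (AdjoinRoot.root b)).natDegree :=
    natDegree_eq_of_degree_eq (degree_eq_degree_of_associated
      ((minpoly.irreducible (IsIntegral.of_finite K _)).associated_of_dvd hh
        (minpoly.dvd K _ hroot)).symm)
  have h2 := minpoly.natDegree_le (A := K) (AdjoinRoot.root b)
  rw [← h1, hd, ← Module.finrank_mul_finrank K L (AdjoinRoot b),
    (AdjoinRoot.powerBasis hb.ne_zero).finrank, AdjoinRoot.powerBasis_dim] at h2
  exact Nat.le_of_mul_le_mul_left h2 Module.finrank_pos

/-- Meant for `E = K(T)` and `E' = L(T)`: constants come from `θ`, the variable from `K[T]` through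
`hE`, and the rest are quotients. -/
theorem adjoin_algebraMap_C_eq_top {K L E E' : Type*} [Field K] [Field L] [Algebra K L]
    [Field E] [Field E'] [Algebra E E'] [Algebra L[X] E'] [IsFractionRing L[X] E']
    (hE : ∀ p : K[X], algebraMap L[X] E' (p.map (algebraMap K L)) ∈ (algebraMap E E').range)
    (θ : L) (hθ : K⟮θ⟯ = ⊤) : E⟮algebraMap L[X] E' (C θ)⟯ = ⊤ := by
  set M := E⟮algebraMap L[X] E' (C θ)⟯ with hM
  have hK : ∀ p : K[X], algebraMap L[X] E' (p.map (algebraMap K L)) ∈ M := by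
    intro p
    obtain ⟨e, he⟩ := hE p
    exact he ▸ M.algebraMap_mem e
  have hC : ∀ a : L, algebraMap L[X] E' (C a) ∈ M := by
    intro a
    have ha : a ∈ K⟮θ⟯ := hθ ▸ mem_top
    induction ha using adjoin_induction with
    | mem x hx => rw [Set.mem_singleton_iff.1 hx]; exact mem_adjoin_simple_self _ _
    | algebraMap x => simpa using hK (C x)
    | add x y _ _ hx hy => rw [C_add, map_add]; exact add_mem hx hy
    | mul x y _ _ hx hy => rw [C_mul, map_mul]; exact mul_mem hx hy
    | inv x _ hx =>
      have h := map_inv₀ ((algebraMap L[X] E').comp C) x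
      rw [RingHom.comp_apply, RingHom.comp_apply] at h
      exact h ▸ inv_mem hx
  have hX : algebraMap L[X] E' X ∈ M := by simpa using hK X
  have hpoly : ∀ p : L[X], algebraMap L[X] E' p ∈ M := by
    intro p
    induction p using Polynomial.induction_on' with
    | add p q hp hq => rw [map_add]; exact add_mem hp hq
    | monomial n a =>
      rw [← C_mul_X_pow_eq_monomial, map_mul, map_pow]
      exact mul_mem (hC a) (pow_mem hX n)
  rw [eq_top_iff]
  rintro y -
  obtain ⟨p, q, -, rfl⟩ := IsFractionRing.div_surjective (A := L[X]) y
  exact div_mem (hpoly p) (hpoly q)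

attribute [local instance] Polynomial.algebra FractionRing.liftAlgebra in
theorem exists_irreducible_dvd_taylor_polynomial {K L : Type*} [Field K] [CharZero K] [Field L]
    [Algebra K L] [FiniteDimensional K L] (f : L[X][X]) (hf : Irreducible f)
    (hdeg : 1 ≤ f.natDegree) :
    ∃ (θ : L[X]) (h : K[X][X]), Irreducible h ∧
      h.natDegree = Module.finrank K L * f.natDegree ∧
      f ∣ taylor θ (h.map (mapRingHom (algebraMap K L))) := by
  obtain ⟨θ, hθ⟩ := Field.exists_primitive_element K L
  have hrank : Module.finrank (FractionRing K[X]) (FractionRing L[X]) = Module.finrank K L := by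
    rw [IsFractionRing.finrank_eq K[X] (FractionRing K[X]) L[X] (FractionRing L[X])]
    exact congrArg _ (rank_polynomial_polynomial K L)
  have : FiniteDimensional (FractionRing K[X]) (FractionRing L[X]) :=
    .of_finrank_pos (hrank ▸ Module.finrank_pos)
  have hE (p : K[X]) : algebraMap L[X] (FractionRing L[X]) (p.map (algebraMap K L)) ∈
      (algebraMap (FractionRing K[X]) (FractionRing L[X])).range :=
    ⟨algebraMap K[X] _ p, by
      rw [← IsScalarTower.algebraMap_apply, IsScalarTower.algebraMap_apply K[X] L[X]]; rfl⟩
  obtain ⟨c, h, h1, h2, h3⟩ := exists_irreducible_dvd_taylor (R := K[X]) (E := FractionRing K[X])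
    (E' := FractionRing L[X]) (C θ) (adjoin_algebraMap_C_eq_top hE θ hθ) f hf hdeg
  exact ⟨_, h, h1, hrank ▸ h2, h3⟩

/-- Undoing the shift, every nonunit factor of `g` has degree at least `deg g`, which leaves no room
for two of them. -/
theorem irreducible_of_dvd_taylor {K L : Type*} [Field K] [Field L] [Algebra K L]
    [FiniteDimensional K L] {h : K[X]} (hh : Irreducible h) {g : L[X]} (hg : 1 ≤ g.natDegree)
    (hd : h.natDegree = Module.finrank K L * g.natDegree) (θ : L)
    (hdvd : g ∣ taylor θ (h.map (algebraMap K L))) : Irreducible g := by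
  have key : ∀ a : L[X], ¬ IsUnit a → a ∣ g → g.natDegree ≤ a.natDegree := by
    intro a ha hag
    rw [← natDegree_taylor a (-θ)]
    refine finrank_le_natDegree_of_dvd_map hh hd ?_ ?_
    · exact fun hu ↦ ha ((isUnit_map_iff (taylorEquiv (-θ)) a).1 hu)
    · have := map_dvd (taylorEquiv (-θ)) (hag.trans hdvd)
      change taylor (-θ) a ∣ taylor (-θ) (taylor θ _) at this
      simpa [taylor_taylor] using this
  have hg0 : g ≠ 0 := by rintro rfl; simp at hg
  refine ⟨fun hu ↦ by rw [natDegree_eq_zero_of_isUnit hu] at hg; omega, fun a b hab ↦ ?_⟩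
  by_contra! hcon
  have h1 := key a hcon.1 ⟨b, hab⟩
  have h2 := key b hcon.2 ⟨a, by rw [hab, mul_comm]⟩
  have h3 : g.natDegree = a.natDegree + b.natDegree := by
    rw [hab, natDegree_mul] <;> rintro rfl <;> simp [hg0] at hab
  omega

/-- A finite extension of a Hilbertian field of characteristic zero is Hilbertian. -/
theorem IsHilbertian.of_finiteDimensional {K L : Type*} [Field K] [CharZero K] [Field L]
    [Algebra K L] [FiniteDimensional K L] (hK : IsHilbertian K) : IsHilbertian L := by
  classical
  intro f hf hdeg
  obtain ⟨θ, h, hh, hd, hdvd⟩ := exists_irreducible_dvd_taylor_polynomial (K := K) f hf hdeg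
  have hf0 : f.leadingCoeff ≠ 0 := leadingCoeff_ne_zero.2 hf.ne_zero
  have hh0 : h.leadingCoeff ≠ 0 := leadingCoeff_ne_zero.2 hh.ne_zero
  have hhdeg : 1 ≤ h.natDegree := hd ▸ Nat.mul_pos Module.finrank_pos hdeg
  -- Points where a leading coefficient vanishes are discarded, so that the relation between the
  -- degrees of `h` and `f` survives specialization.
  have hfin₁ : {t : K | h.leadingCoeff.eval t = 0}.Finite :=
    (h.leadingCoeff.roots.toFinset.finite_toSet).subset fun t ht ↦ by simpa [hh0] using ht
  have hfin₂ : {t : K | f.leadingCoeff.eval (algebraMap K L t) = 0}.Finite :=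
    ((f.leadingCoeff.roots.toFinset.finite_toSet).preimage
      (algebraMap K L).injective.injOn).subset fun t ht ↦ by simpa [hf0] using ht
  have hinf := ((hK h hh hhdeg).sdiff (hfin₁.union hfin₂)).image (algebraMap K L).injective.injOn
  refine hinf.mono ?_
  rintro _ ⟨t, ⟨ht, hbad⟩, rfl⟩
  simp only [Set.mem_union, Set.mem_ofPred_eq, not_or] at hbad ht ⊢
  have hfd : (f.map (evalRingHom (algebraMap K L t))).natDegree = f.natDegree :=
    natDegree_map_of_leadingCoeff_ne_zero _ (by simpa using hbad.2)
  have hhd : (h.map (evalRingHom t)).natDegree = h.natDegree :=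
    natDegree_map_of_leadingCoeff_ne_zero _ (by simpa using hbad.1)
  refine irreducible_of_dvd_taylor ht (hfd ▸ hdeg) (by rw [hfd, hhd, hd])
    (θ.eval (algebraMap K L t)) ?_
  have := map_dvd (mapRingHom (evalRingHom (algebraMap K L t))) hdvd
  rw [coe_mapRingHom, Polynomial.map_taylor, Polynomial.map_map] at this
  rw [Polynomial.map_map]
  have hcomp : (algebraMap K L).comp (evalRingHom t) =
      (evalRingHom (algebraMap K L t)).comp (mapRingHom (algebraMap K L)) := by
    ext <;> simp
  rw [hcomp]
  exact this

/-! ### Enlarging a field inside a vast extension -/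

/-- As `N` is Galois, disjointness is linear disjointness, so the degree formula holds for every `G
≤ N`. Both `F` and `F(a) ∩ N` have compositum `F(a)` with `B(a)`; hence they have equal degree and
coincide. -/
theorem finrank_sup_adjoin_of_disjoint {B Ω : Type*} [Field B] [Field Ω] [Algebra B Ω]
    {F N : IntermediateField B Ω} (hFN : F ≤ N) [FiniteDimensional B N] [IsGalois B N]
    {a : Ω} (ha : IsIntegral B a) (hdisj : Disjoint B⟮a⟯ N) :
    Module.finrank B ↥(F ⊔ B⟮a⟯) = Module.finrank B F * Module.finrank B B⟮a⟯ ∧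
      (F ⊔ B⟮a⟯) ⊓ N ≤ F := by
  have : FiniteDimensional B B⟮a⟯ := adjoin.finiteDimensional ha
  have hlin : N.LinearDisjoint B⟮a⟯ := .of_inf_eq_bot (inf_comm N B⟮a⟯ ▸ hdisj.eq_bot)
  have hF : ∀ G ≤ N, Module.finrank B ↥(G ⊔ B⟮a⟯) =
      Module.finrank B G * Module.finrank B B⟮a⟯ :=
    fun G hG ↦ (hlin.of_le_left hG).finrank_sup
  refine ⟨hF F hFN, ?_⟩
  have hle : F ≤ (F ⊔ B⟮a⟯) ⊓ N := le_inf le_sup_left hFN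
  have hsup : (F ⊔ B⟮a⟯) ⊓ N ⊔ B⟮a⟯ = F ⊔ B⟮a⟯ :=
    le_antisymm (sup_le inf_le_left le_sup_right) (sup_le_sup_right hle _)
  have h1 := hF _ (inf_le_right : (F ⊔ B⟮a⟯) ⊓ N ≤ N)
  rw [hsup, hF F hFN] at h1
  have h2 := Nat.eq_of_mul_eq_mul_right Module.finrank_pos h1
  have : FiniteDimensional B ↥((F ⊔ B⟮a⟯) ⊓ N) :=
    .of_injective (inclusion inf_le_right).toLinearMap (inclusion_injective inf_le_right)
  exact (eq_of_le_of_finrank_eq hle h2).ge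

theorem padicValNat_finrank_adjoin_le {B Ω : Type*} [Field B] [Field Ω] [Algebra B Ω]
    (L : IntermediateField B Ω) {a : Ω} (haL : a ∈ L) (ha : IsIntegral B a) (p : Nat.Primes) :
    (padicValNat p (Module.finrank B B⟮a⟯) : ℕ∞) ≤ (supernaturalDegree B L).exponent p := by
  have ha' : IsIntegral B (⟨a, haL⟩ : L) :=
    (isIntegral_algHom_iff L.val L.val.injective).1 ha
  have hfin : FiniteDimensional B B⟮(⟨a, haL⟩ : L)⟯ := adjoin.finiteDimensional ha'
  have : Module.finrank B B⟮a⟯ = Module.finrank B B⟮(⟨a, haL⟩ : L)⟯ := by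
    rw [adjoin.finrank ha, adjoin.finrank ha',
      ← minpoly.algebraMap_eq (algebraMap L Ω).injective (⟨a, haL⟩ : L)]
    rfl
  rw [this]
  exact le_iSup₂_of_le (f := fun (M : IntermediateField B L) (_ : FiniteDimensional B M) ↦
    (padicValNat p (Module.finrank B M) : ℕ∞)) _ hfin le_rfl

theorem finrank_restrictScalars_eq_mul {k B Ω : Type*} [Field k] [Field B] [Field Ω]
    [Algebra k B] [Algebra B Ω] [Algebra k Ω] [IsScalarTower k B Ω] (G : IntermediateField B Ω) :
    Module.finrank k (G.restrictScalars k) = Module.finrank k B * Module.finrank B G :=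
  (Module.finrank_mul_finrank k B G).symm

theorem finiteDimensional_restrictScalars {k B Ω : Type*} [Field k] [Field B] [Field Ω]
    [Algebra k B] [Algebra B Ω] [Algebra k Ω] [IsScalarTower k B Ω] [FiniteDimensional k B]
    (G : IntermediateField B Ω) [FiniteDimensional B G] :
    FiniteDimensional k (G.restrictScalars k) :=
  FiniteDimensional.trans k B G

theorem finiteDimensional_extendScalars {k Ω : Type*} [Field k] [Field Ω] [Algebra k Ω]
    {B N : IntermediateField k Ω} (h : B ≤ N) [FiniteDimensional k N] :
    FiniteDimensional B (extendScalars h) :=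
  have : FiniteDimensional k (extendScalars h) := ‹FiniteDimensional k N›
  Module.Finite.of_restrictScalars_finite k B _

theorem isGalois_extendScalars {k Ω : Type*} [Field k] [Field Ω] [Algebra k Ω]
    {B N : IntermediateField k Ω} (h : B ≤ N) [IsGalois k N] :
    IsGalois B (extendScalars h) :=
  have : IsGalois k (extendScalars h) := ‹IsGalois k N›
  IsGalois.tower_top_of_isGalois k B _

theorem IsVast.exists_sup_extension {k Ω : Type*} [Field k] [CharZero k] [Field Ω] [Algebra k Ω]
    {F N : IntermediateField k Ω} (hFN : F ≤ N) [FiniteDimensional k N] [Normal k N]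
    (E : ExtensionInside k Ω) (hE : E.base ≤ F) (hv : IsVast E.top) :
    ∃ (F' : IntermediateField k Ω) (e : ℕ), F ≤ F' ∧ FiniteDimensional k F' ∧
      Module.finrank k F' = Module.finrank k F * e ∧
      (∀ p : Nat.Primes, (padicValNat p e : ℕ∞) ≤ (supernaturalDegree E.base E.top).exponent p) ∧
      F' ⊓ N ≤ F ∧ ∃ a ∈ F', a ∈ E.top ∧ a ∉ E.base := by
  obtain ⟨B, L⟩ := E
  dsimp only at *
  let F₁ : IntermediateField B Ω := extendScalars hE
  let N₁ : IntermediateField B Ω := extendScalars (hE.trans hFN)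
  have hFN₁ : F₁ ≤ N₁ := hFN
  have : IsGalois k N := ⟨⟩
  have : IsGalois B N₁ := isGalois_extendScalars _
  have : FiniteDimensional B N₁ := finiteDimensional_extendScalars _
  obtain ⟨halg, -, hdis⟩ := hv
  obtain ⟨M, hM, hML, hdisj⟩ := hdis N₁ inferInstance
  obtain ⟨a, haM, haB⟩ := SetLike.exists_of_lt (bot_lt_iff_ne_bot.2 hM)
  have haL : a ∈ L := hML haM
  have haint : IsIntegral B a :=
    (isIntegral_algHom_iff L.val L.val.injective).2
      (Algebra.IsAlgebraic.isAlgebraic (R := B) (⟨a, haL⟩ : L)).isIntegral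
  obtain ⟨hrank, hinf⟩ := finrank_sup_adjoin_of_disjoint hFN₁ haint
    (hdisj.mono_left (adjoin_simple_le_iff.2 haM))
  have : FiniteDimensional B B⟮a⟯ := adjoin.finiteDimensional haint
  have : FiniteDimensional B F₁ :=
    .of_injective (inclusion hFN₁).toLinearMap (inclusion_injective hFN₁)
  have : FiniteDimensional k B :=
    .of_injective (inclusion (hE.trans hFN)).toLinearMap
      (inclusion_injective (hE.trans hFN))
  obtain ⟨G, hG⟩ : ∃ G, G = F₁ ⊔ B⟮a⟯ := ⟨_, rfl⟩
  have hFG : F₁ ≤ G := hG ▸ le_sup_left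
  have haG : a ∈ G := (hG ▸ le_sup_right : B⟮a⟯ ≤ G) (mem_adjoin_simple_self B a)
  have : FiniteDimensional B G := hG ▸ inferInstance
  rw [← hG] at hrank hinf
  refine ⟨G.restrictScalars k, Module.finrank B B⟮a⟯, fun x hx ↦ hFG hx,
    finiteDimensional_restrictScalars G, ?_, padicValNat_finrank_adjoin_le L haL haint,
    fun x hx ↦ hinf ⟨hx.1, hx.2⟩, a, haG, haL, fun h ↦ haB (mem_bot.2 ⟨⟨a, h⟩, rfl⟩)⟩
  have hF : F₁.restrictScalars k = F := extendScalars_restrictScalars hE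
  rw [finrank_restrictScalars_eq_mul, hrank, ← mul_assoc, ← finrank_restrictScalars_eq_mul, hF]

/-! ### Irreducibility under change of field -/

/-- The polynomial `q` has coefficients in `F` and is irreducible over `F`. -/
def IrreducibleOver {k Ω : Type*} [Field k] [Field Ω] [Algebra k Ω] (F : IntermediateField k Ω)
    (q : Polynomial Ω) : Prop :=
  ∃ g : F[X], Irreducible g ∧ g.map (algebraMap F Ω) = q

/-- The polynomial `f` in two variables has coefficients in `F` and is irreducible over `F`. -/
def IrreducibleOver₂ {k Ω : Type*} [Field k] [Field Ω] [Algebra k Ω] (F : IntermediateField k Ω)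
    (f : (Polynomial Ω)[X]) : Prop :=
  ∃ g : F[X][X], Irreducible g ∧ g.map (mapRingHom (algebraMap F Ω)) = f

/-- The coefficients of a monic factor over `F'` lie in `F'`, and also in `N` because its roots do.
So they lie in `F`, and the factor already divides over `F`. -/
theorem IrreducibleOver.of_le {k Ω : Type*} [Field k] [Field Ω] [Algebra k Ω] [IsAlgClosed Ω]
    {F F' N : IntermediateField k Ω} (hF : F ≤ F') (hN : F' ⊓ N ≤ F) {q : Polynomial Ω}
    (hroots : ∀ x ∈ q.roots, x ∈ N) (hq : IrreducibleOver F q) : IrreducibleOver F' q := by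
  obtain ⟨g, hg, rfl⟩ := hq
  set g' : F'[X] := g.map (inclusion hF).toRingHom with hg'def
  have hg' : g'.map (algebraMap F' Ω) = g.map (algebraMap F Ω) := by
    rw [hg'def, Polynomial.map_map]; rfl
  have hgΩ0 : g.map (algebraMap F Ω) ≠ 0 := by
    rw [Ne, Polynomial.map_eq_zero]; exact hg.ne_zero
  refine ⟨g', ?_, hg'⟩
  have hg'0 : g' ≠ 0 := by
    rw [hg'def, Ne, Polynomial.map_eq_zero]; exact hg.ne_zero
  have hg'u : ¬ IsUnit g' := by
    rw [hg'def, isUnit_map]; exact hg.not_isUnit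
  obtain ⟨a, hamon, hairr, hadvd⟩ := exists_monic_irreducible_factor g' hg'u
  have hadvdΩ : a.map (algebraMap F' Ω) ∣ g.map (algebraMap F Ω) :=
    hg' ▸ Polynomial.map_dvd (algebraMap F' Ω) hadvd
  have haN : a.map (algebraMap F' Ω) ∈ lifts (algebraMap N Ω) := by
    refine Splits.mem_lift_of_roots_mem_range (IsAlgClosed.splits _) (hamon.map _) _ ?_
    intro x hx
    exact ⟨⟨x, hroots x (Multiset.mem_of_le (roots.le_of_dvd hgΩ0 hadvdΩ) hx)⟩, rfl⟩
  have haF : a.map (algebraMap F' Ω) ∈ lifts (algebraMap F Ω) := by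
    rw [lifts_iff_coeff_lifts] at haN ⊢
    intro n
    obtain ⟨y, hy⟩ := haN n
    refine ⟨⟨(a.map (algebraMap F' Ω)).coeff n, hN ⟨?_, ?_⟩⟩, rfl⟩
    · rw [coeff_map]; exact (a.coeff n).2
    · rw [← hy]; exact y.2
  obtain ⟨b, hb⟩ := (mem_lifts _).1 haF
  have hbg : b ∣ g := by
    rw [← hb] at hadvdΩ
    exact (map_dvd_map' (algebraMap F Ω)).1 hadvdΩ
  have hbu : ¬ IsUnit b := by
    intro hu
    have h1 := (isUnit_map (algebraMap F Ω)).2 hu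
    rw [hb, isUnit_map] at h1
    exact hairr.not_isUnit h1
  have hgb : g ∣ b := ((hg.dvd_iff.1 hbg).resolve_left hbu).dvd
  have hga : g' ∣ a := by
    rw [← map_dvd_map' (algebraMap F' Ω), hg', ← hb]
    exact Polynomial.map_dvd _ hgb
  exact (associated_of_dvd_dvd hadvd hga).irreducible hairr

theorem isLocalHom_mapRingHom {R S : Type*} [CommRing R] [IsDomain R] [CommRing S] [IsDomain S]
    (φ : R →+* S) (hφ : Function.Injective φ) [IsLocalHom φ] : IsLocalHom (mapRingHom φ) := by
  refine ⟨fun p hp ↦ ?_⟩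
  obtain ⟨u, hu, hup⟩ := isUnit_iff.1 hp
  have h0 : p.natDegree = 0 := by
    rw [← natDegree_map_eq_of_injective hφ, ← coe_mapRingHom, ← hup, natDegree_C]
  obtain ⟨r, rfl⟩ := natDegree_eq_zero.1 h0
  rw [coe_mapRingHom, map_C, C_inj] at hup
  exact isUnit_C.2 (isUnit_of_map_unit φ r (hup ▸ hu))

/-- A factorization over `G` is also one over `F`, and the inclusion of polynomial rings reflects
units. -/
theorem IrreducibleOver₂.of_coeff_mem {k Ω : Type*} [Field k] [Field Ω] [Algebra k Ω]
    {F G : IntermediateField k Ω} (hGF : G ≤ F) {f : (Polynomial Ω)[X]} (hf : IrreducibleOver₂ F f)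
    (hcoeff : ∀ i j, (f.coeff i).coeff j ∈ G) : IrreducibleOver₂ G f := by
  obtain ⟨g, hg, hgf⟩ := hf
  have hlift : f ∈ lifts (mapRingHom (algebraMap G Ω)) := by
    rw [lifts_iff_coeff_lifts]
    intro i
    have : f.coeff i ∈ lifts (algebraMap G Ω) := by
      rw [lifts_iff_coeff_lifts]
      exact fun j ↦ ⟨⟨_, hcoeff i j⟩, rfl⟩
    obtain ⟨r, hr⟩ := (mem_lifts _).1 this
    exact ⟨r, hr⟩
  obtain ⟨r, hr⟩ := (mem_lifts _).1 hlift
  refine ⟨r, ?_, hr⟩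
  let i : G →+* F := (inclusion hGF).toRingHom
  have := isLocalHom_mapRingHom i i.injective
  have := isLocalHom_mapRingHom (mapRingHom i) (map_injective i i.injective)
  have hrg : mapRingHom (mapRingHom i) r = g := by
    apply map_injective (mapRingHom (algebraMap F Ω)) (map_injective _ (algebraMap F Ω).injective)
    rw [hgf, ← hr, coe_mapRingHom, Polynomial.map_map, mapRingHom_comp]
    rfl
  exact Irreducible.of_map (f := mapRingHom (mapRingHom i)) (hrg ▸ hg)

/-! ### Finite approximations and their refinements -/

/-- The field `F` meets the extension `E` outside of its base field. -/
def ExtensionInside.Meets {k Ω : Type*} [Field k] [Field Ω] [Algebra k Ω]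
    (E : ExtensionInside k Ω) (F : IntermediateField k Ω) : Prop :=
  ∃ a ∈ F, a ∈ E.top ∧ a ∉ E.base

/-- A finite approximation of the field to be constructed: a finite extension `field` of `k`,
whose degree is accounted for by finitely many extensions in `A` that it meets, and a finite
normal extension `hull` that is to stay disjoint from all that is added to `field` later on. -/
structure Approx {k Ω : Type*} [Field k] [Field Ω] [Algebra k Ω]
    (A : Set (ExtensionInside k Ω)) where
  field : IntermediateField k Ω
  hull : IntermediateField k Ω
  field_le_hull : field ≤ hull
  finite_hull : FiniteDimensional k hull
  normal_hull : Normal k hull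
  exists_degree : ∃ (U : Finset A) (d : A → ℕ),
    Module.finrank k field = ∏ E ∈ U, d E ∧
    ∀ E ∈ U, (∀ p : Nat.Primes, (padicValNat p (d E) : ℕ∞) ≤
      (supernaturalDegree E.1.base E.1.top).exponent p) ∧ E.1.Meets field

namespace Approx

variable {k Ω : Type*} [Field k] [Field Ω] [Algebra k Ω] {A : Set (ExtensionInside k Ω)}

/-- The third clause is the promise that later fields acquire no new elements of an earlier hull. -/
instance : Preorder (Approx A) where
  le p q := p.field ≤ q.field ∧ p.hull ≤ q.hull ∧ q.field ⊓ p.hull ≤ p.field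
  le_refl p := ⟨le_rfl, le_rfl, inf_le_left⟩
  le_trans p q r hpq hqr := ⟨hpq.1.trans hqr.1, hpq.2.1.trans hqr.2.1,
    (le_inf (le_trans (inf_le_inf_left _ hpq.2.1) hqr.2.2) inf_le_right).trans hpq.2.2⟩

theorem field_mono {p q : Approx A} (h : p ≤ q) : p.field ≤ q.field := h.1

theorem field_inf_hull_le {p q : Approx A} (h : p ≤ q) : q.field ⊓ p.hull ≤ p.field := h.2.2

theorem finite_field (p : Approx A) : FiniteDimensional k p.field :=
  have := p.finite_hull
  .of_injective (inclusion p.field_le_hull).toLinearMap (inclusion_injective p.field_le_hull)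

instance : Inhabited (Approx A) where
  default :=
    { field := ⊥
      hull := ⊥
      field_le_hull := le_rfl
      finite_hull := inferInstance
      normal_hull := inferInstance
      exists_degree := ⟨∅, 1, by simp, by simp⟩ }

/-- Enlarge the hull of an approximation so that it contains a given finite extension. -/
theorem exists_le_hull [Normal k Ω] (p : Approx A) (G : IntermediateField k Ω)
    [FiniteDimensional k G] : ∃ q : Approx A, p ≤ q ∧ q.field = p.field ∧ G ≤ q.hull := by
  have := p.finite_hull
  have hle : p.hull ⊔ G ≤ normalClosure k ↥(p.hull ⊔ G) Ω := le_normalClosure _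
  exact ⟨{ p with
    hull := normalClosure k ↥(p.hull ⊔ G) Ω
    field_le_hull := p.field_le_hull.trans (le_sup_left.trans hle)
    finite_hull := inferInstance
    normal_hull := inferInstance }, ⟨le_rfl, le_sup_left.trans hle, inf_le_left⟩, rfl,
    le_sup_right.trans hle⟩

theorem exists_meets [CharZero k] [Normal k Ω] (hvast : ∀ E ∈ A, IsVast E.top) (p : Approx A)
    (E : A) (hE : E.1.base ≤ p.field) : ∃ q : Approx A, p ≤ q ∧ E.1.Meets q.field := by
  classical
  by_cases hmeet : E.1.Meets p.field
  · exact ⟨p, le_rfl, hmeet⟩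
  have := p.finite_hull
  have := p.normal_hull
  obtain ⟨F, e, hF, hfin, hrank, hval, hinf, hF'⟩ :=
    (hvast E.1 E.2).exists_sup_extension p.field_le_hull E.1 hE
  obtain ⟨U, d, hd, hU⟩ := p.exists_degree
  -- Extensions already accounted for are met, so an unmet one is new: no factor of the product is
  -- used twice.
  have hEU : E ∉ U := fun h ↦ hmeet (hU E h).2
  have hle : p.hull ⊔ F ≤ normalClosure k ↥(p.hull ⊔ F) Ω := le_normalClosure _
  refine ⟨{
    field := F
    hull := normalClosure k ↥(p.hull ⊔ F) Ω
    field_le_hull := le_sup_right.trans hle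
    finite_hull := inferInstance
    normal_hull := inferInstance
    exists_degree := ⟨insert E U, Function.update d E e, ?_, ?_⟩ },
    ⟨hF, le_sup_left.trans hle, hinf⟩, hF'⟩
  · rw [Finset.prod_insert hEU, Function.update_self, hrank, hd, mul_comm]
    congr 1
    exact Finset.prod_congr rfl fun E' hE' ↦
      (Function.update_of_ne (ne_of_mem_of_not_mem hE' hEU) _ _).symm
  · intro E' hE'
    obtain rfl | hne := eq_or_ne E' E
    · rw [Function.update_self]
      exact ⟨hval, hF'⟩
    · rw [Function.update_of_ne hne]
      obtain ⟨h1, a, ha, ha'⟩ := hU E' ((Finset.mem_insert.1 hE').resolve_left hne)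
      exact ⟨h1, a, hF ha, ha'⟩

/-- At least `m` specializations of `f` are irreducible over the field of `p`, with all their
roots in the hull of `p`. -/
def Specializes (p : Approx A) (f : (Polynomial Ω)[X]) (m : ℕ) : Prop :=
  ∃ T : Finset Ω, T.card = m ∧ ∀ t ∈ T, t ∈ p.field ∧
    IrreducibleOver p.field (f.map (evalRingHom t)) ∧
    ∀ x ∈ (f.map (evalRingHom t)).roots, x ∈ p.hull

theorem exists_specializes [CharZero k] [Normal k Ω] (hk : IsHilbertian k) (p : Approx A)
    (f : (Polynomial Ω)[X]) (hdeg : 1 ≤ f.natDegree) (hf : IrreducibleOver₂ p.field f) (m : ℕ) :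
    ∃ q : Approx A, p ≤ q ∧ q.Specializes f m := by
  classical
  have := p.finite_field
  obtain ⟨g, hg, rfl⟩ := hf
  rw [natDegree_map_eq_of_injective (map_injective _ (algebraMap p.field Ω).injective)] at hdeg
  obtain ⟨T, hT, hcard⟩ := (hk.of_finiteDimensional g hg hdeg).exists_subset_card_eq m
  set f := g.map (mapRingHom (algebraMap p.field Ω))
  -- The hull must absorb the roots of the chosen specializations; the field itself does not change.
  let R : Finset Ω := T.biUnion fun t ↦ (f.map (evalRingHom (t : Ω))).roots.toFinset
  have hR : FiniteDimensional k (adjoin k (R : Set Ω)) :=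
    finiteDimensional_adjoin fun x _ ↦ Normal.isIntegral inferInstance x
  obtain ⟨q, hpq, hfield, hhull⟩ := p.exists_le_hull (adjoin k (R : Set Ω))
  refine ⟨q, hpq, T.map ⟨_, Subtype.val_injective⟩, by simpa using hcard, ?_⟩
  intro t ht
  obtain ⟨t, htT, rfl⟩ := Finset.mem_map.1 ht
  rw [Function.Embedding.coeFn_mk, hfield]
  refine ⟨t.2, ⟨_, hT htT, ?_⟩, fun x hx ↦ hhull (subset_adjoin k _ ?_)⟩
  · rw [Polynomial.map_map, Polynomial.map_map]
    congr 1
    ext <;> simp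
  · exact Finset.mem_biUnion.2 ⟨t, htT, Multiset.mem_toFinset.2 hx⟩

end Approx

/-! ### The generic chain and its union -/

theorem exists_subset_of_finite_of_subset_iSup {k Ω : Type*} [Field k] [Field Ω] [Algebra k Ω]
    {G : ℕ → IntermediateField k Ω} (hG : Monotone G) {s : Set Ω} (hs : s.Finite)
    (hsub : ∀ x ∈ s, x ∈ ⨆ n, G n) : ∃ n, ∀ x ∈ s, x ∈ G n := by
  have h1 : ∀ x ∈ s, ∃ n, x ∈ G n := fun x hx ↦ by
    have := hsub x hx
    rwa [← SetLike.mem_coe, coe_iSup_of_directed hG.directed_le, Set.mem_iUnion] at this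
  choose! m hm using h1
  obtain ⟨n, hn⟩ := (hs.image m).bddAbove
  exact ⟨n, fun x hx ↦ hG (hn ⟨x, hx, rfl⟩) (hm x hx)⟩

theorem exists_le_of_finiteDimensional_of_le_iSup {k Ω : Type*} [Field k] [Field Ω] [Algebra k Ω]
    {G : ℕ → IntermediateField k Ω} (hG : Monotone G) {B : IntermediateField k Ω}
    [FiniteDimensional k B] (hB : B ≤ ⨆ n, G n) : ∃ n, B ≤ G n := by
  obtain ⟨s, rfl⟩ := B.fg_of_fg_toSubalgebra
    (B.toSubalgebra.fg_iff_finiteType.2 (inferInstanceAs (Algebra.FiniteType k B)))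
  obtain ⟨n, hn⟩ := exists_subset_of_finite_of_subset_iSup hG s.finite_toSet
    fun x hx ↦ hB (subset_adjoin k _ hx)
  exact ⟨n, adjoin_le_iff.2 hn⟩

theorem Polynomial.finite_setOf_coeff_coeff {R : Type*} [Semiring R] (f : R[X][X]) :
    {x | ∃ i j, (f.coeff i).coeff j = x}.Finite := by
  have h : ∀ p : R[X], {x | ∃ j, p.coeff j = x}.Finite := fun p ↦
    ((p.coeffs.finite_toSet).insert 0).subset fun x ⟨j, hj⟩ ↦ by
      by_cases h0 : p.coeff j = 0
      · exact Or.inl (hj ▸ h0)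
      · exact Or.inr (hj ▸ coeff_mem_coeffs h0)
  refine (((f.coeffs.finite_toSet).insert 0).biUnion fun p _ ↦ h p).subset ?_
  rintro x ⟨i, j, hx⟩
  refine Set.mem_biUnion (x := f.coeff i) ?_ ⟨j, hx⟩
  by_cases h0 : f.coeff i = 0
  · exact Or.inl h0
  · exact Or.inr (coeff_mem_coeffs h0)

theorem Polynomial.countable {R : Type*} [Semiring R] [Countable R] : Countable R[X] :=
  Cardinal.mk_le_aleph0_iff.1
    (cardinalMk_le_max.trans (max_le (Cardinal.mk_le_aleph0_iff.2 ‹_›) le_rfl))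

namespace Approx

variable {k Ω : Type*} [Field k] [Field Ω] [Algebra k Ω] {A : Set (ExtensionInside k Ω)}

/-- The approximations that meet `E`, or whose refinements never contain the base of `E`. -/
def meetsCofinal [CharZero k] [Normal k Ω] (hvast : ∀ E ∈ A, IsVast E.top) (E : A) :
    Order.Cofinal (Approx A) where
  carrier := {p | (∀ q ≥ p, ¬ E.1.base ≤ q.field) ∨ E.1.Meets p.field}
  isCofinal p := by
    by_cases h : ∀ q ≥ p, ¬ E.1.base ≤ q.field
    · exact ⟨p, Or.inl h, le_rfl⟩
    · push Not at h
      obtain ⟨q, hpq, hq⟩ := h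
      obtain ⟨r, hqr, hr⟩ := q.exists_meets hvast E hq
      exact ⟨r, Or.inr hr, hpq.trans hqr⟩

/-- The approximations that have `m` irreducible specializations of `f`, or over whose refinements
`f` is never irreducible. -/
def specializesCofinal [CharZero k] [Normal k Ω] (hk : IsHilbertian k) (f : (Polynomial Ω)[X])
    (m : ℕ) : Order.Cofinal (Approx A) where
  carrier := {p | (∀ q ≥ p, ¬ (1 ≤ f.natDegree ∧ IrreducibleOver₂ q.field f)) ∨ p.Specializes f m}
  isCofinal p := by
    by_cases h : ∀ q ≥ p, ¬ (1 ≤ f.natDegree ∧ IrreducibleOver₂ q.field f)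
    · exact ⟨p, Or.inl h, le_rfl⟩
    · push Not at h
      obtain ⟨q, hpq, hdeg, hq⟩ := h
      obtain ⟨r, hqr, hr⟩ := q.exists_specializes hk f hdeg hq m
      exact ⟨r, Or.inr hr, hpq.trans hqr⟩

/-- A generic increasing sequence of approximations. -/
theorem exists_generic [CharZero k] [Normal k Ω] [Countable Ω] (hk : IsHilbertian k)
    (hA : A.Countable) (hvast : ∀ E ∈ A, IsVast E.top) :
    ∃ P : ℕ → Approx A, Monotone P ∧
      (∀ E : A, ∃ n, P n ∈ meetsCofinal hvast E) ∧
      ∀ f m, ∃ n, P n ∈ specializesCofinal hk f m := by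
  have : Countable A := hA.to_subtype
  have : Countable (Polynomial Ω) := Polynomial.countable
  have : Countable (Polynomial Ω)[X] := Polynomial.countable
  let _ : Encodable (A ⊕ (Polynomial Ω)[X] × ℕ) := Encodable.ofCountable _
  -- One requirement for each extension in `A` and each pair `(f, m)`: countably many, as `Ω` is
  -- countable.
  let D : A ⊕ (Polynomial Ω)[X] × ℕ → Order.Cofinal (Approx A) :=
    Sum.elim (meetsCofinal hvast) fun x ↦ specializesCofinal hk x.1 x.2
  exact ⟨Order.sequenceOfCofinals default D, Order.sequenceOfCofinals.monotone _ _,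
    fun E ↦ ⟨_, Order.sequenceOfCofinals.encode_mem default D (Sum.inl E)⟩,
    fun f m ↦ ⟨_, Order.sequenceOfCofinals.encode_mem default D (Sum.inr (f, m))⟩⟩

theorem iSup_inf_hull_le {P : ℕ → Approx A} (hP : Monotone P) (n : ℕ) :
    (⨆ i, (P i).field) ⊓ (P n).hull ≤ (P n).field := by
  rintro x ⟨hx, hxn⟩
  have hmono : Monotone fun i ↦ (P i).field := fun i j hij ↦ field_mono (hP hij)
  rw [SetLike.mem_coe, ← SetLike.mem_coe, coe_iSup_of_directed hmono.directed_le,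
    Set.mem_iUnion] at hx
  obtain ⟨i, hi⟩ := hx
  exact field_inf_hull_le (hP (le_max_right i n)) ⟨hmono (le_max_left i n) hi, hxn⟩

theorem isHilbertian_iSup [CharZero k] [Normal k Ω] [IsAlgClosed Ω] (hk : IsHilbertian k)
    {P : ℕ → Approx A} (hP : Monotone P)
    (hgen : ∀ f m, ∃ n, P n ∈ specializesCofinal hk f m) :
    IsHilbertian ↥(⨆ i, (P i).field) := by
  set F := ⨆ i, (P i).field
  intro g hg hdeg
  have hmono : Monotone fun i ↦ (P i).field := fun i j hij ↦ field_mono (hP hij)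
  set f := g.map (mapRingHom (algebraMap F Ω)) with hf
  have hfdeg : 1 ≤ f.natDegree := by
    rwa [hf, natDegree_map_eq_of_injective (map_injective _ (algebraMap F Ω).injective)]
  have hcoeff : ∀ i j, (f.coeff i).coeff j ∈ F := fun i j ↦ by
    rw [hf, coeff_map, coe_mapRingHom, coeff_map]
    exact ((g.coeff i).coeff j).2
  obtain ⟨n₀, hn₀⟩ := exists_subset_of_finite_of_subset_iSup hmono f.finite_setOf_coeff_coeff
    (by rintro _ ⟨i, j, rfl⟩; exact hcoeff i j)
  intro hfin
  -- One more specialization is requested than the supposedly finite set contains.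
  obtain ⟨n, hn⟩ := hgen f (hfin.toFinset.card + 1)
  obtain h | ⟨T, hT, hTirr⟩ := hn
  -- Late enough in the chain, all coefficients of `f` are present and irreducibility descends from
  -- `F`, so this alternative is impossible.
  · refine h (P (max n n₀)) (hP (le_max_left _ _)) ⟨hfdeg, ?_⟩
    exact IrreducibleOver₂.of_coeff_mem (le_iSup (fun i ↦ (P i).field) _) ⟨g, hg, rfl⟩
      fun i j ↦ hmono (le_max_right _ _) (hn₀ _ ⟨i, j, rfl⟩)
  · have hsub : T ⊆ hfin.toFinset.map ⟨_, Subtype.val_injective⟩ := by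
      intro t ht
      obtain ⟨htF, hirr, hroots⟩ := hTirr t ht
      have hle := le_iSup (fun i ↦ (P i).field) n
      obtain ⟨q, hq, hqf⟩ := hirr.of_le hle (iSup_inf_hull_le hP n) hroots
      refine Finset.mem_map.2 ⟨⟨t, hle htF⟩, hfin.mem_toFinset.2 ?_, rfl⟩
      have : g.map (evalRingHom ⟨t, hle htF⟩) = q := by
        apply map_injective (algebraMap F Ω) (algebraMap F Ω).injective
        rw [hqf, hf, Polynomial.map_map, Polynomial.map_map]
        congr 1
        ext <;> simp
      rw [← this] at hq
      exact hq
    have := Finset.card_le_card hsub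
    rw [Finset.card_map, hT] at this
    omega

/-- A finite subextension lies in a single stage, whose degree is a finite product of factors `d E`
with distinct `E`; its valuation is bounded by a partial sum. -/
theorem supernaturalDegree_iSup_dvd {P : ℕ → Approx A} (hP : Monotone P) :
    supernaturalDegree k ↥(⨆ i, (P i).field) ∣
      Supernatural.prod fun E : A ↦ supernaturalDegree E.1.base E.1.top := by
  intro p
  have hp : Fact (p : ℕ).Prime := ⟨p.2⟩
  have hmono : Monotone fun i ↦ (P i).field := fun i j hij ↦ field_mono (hP hij)
  refine iSup₂_le fun M hM ↦ ?_
  have hlift : FiniteDimensional k (lift M) :=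
    Module.Finite.equiv (liftAlgEquiv M).toLinearEquiv
  obtain ⟨n, hn⟩ := exists_le_of_finiteDimensional_of_le_iSup hmono (lift_le M)
  have := (P n).finite_field
  obtain ⟨U, d, hd, hU⟩ := (P n).exists_degree
  have hdvd : Module.finrank k M ∣ Module.finrank k (P n).field := by
    rw [(liftAlgEquiv M).toLinearEquiv.finrank_eq]
    exact finrank_dvd_of_le_right hn
  have hne : Module.finrank k (P n).field ≠ 0 := Module.finrank_pos.ne'
  have h1 : padicValNat p (Module.finrank k M) ≤ ∑ E ∈ U, padicValNat p (d E) := by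
    have hd0 : ∀ E ∈ U, d E ≠ 0 := Finset.prod_ne_zero_iff.1 (hd ▸ hne)
    simp only [← Nat.factorization_def _ p.2]
    rw [← Finsupp.finsetSum_apply, ← Nat.factorization_prod hd0, ← hd]
    exact (Nat.factorization_le_iff_dvd Module.finrank_pos.ne' hne).2 hdvd p
  calc (padicValNat p (Module.finrank k M) : ℕ∞)
      ≤ ((∑ E ∈ U, padicValNat p (d E) : ℕ) : ℕ∞) := by exact_mod_cast h1
    _ = ∑ E ∈ U, (padicValNat p (d E) : ℕ∞) := by push_cast; rfl
    _ ≤ ∑ E ∈ U, (supernaturalDegree E.1.base E.1.top).exponent p :=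
        Finset.sum_le_sum fun E hE ↦ (hU E hE).1 p
    _ ≤ _ := le_iSup (fun s : Finset A ↦
        ∑ E ∈ s, (supernaturalDegree E.1.base E.1.top).exponent p) U

end Approx

theorem theorem1p4 {k Ω : Type*} [Field k] [CharZero k] [Countable k]
    [Field Ω] [Algebra k Ω] [IsAlgClosure k Ω]
    (hk : IsHilbertian k)
    (A : Set (ExtensionInside k Ω)) (hA : A.Countable)
    (hfin : ∀ E ∈ A, FiniteDimensional k E.base)
    (hvast : ∀ E ∈ A, IsVast E.top) :
    ∃ F : IntermediateField k Ω,
      Algebra.IsAlgebraic k F ∧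
      IsHilbertian F ∧
      supernaturalDegree k F ∣
        Supernatural.prod (fun E : A => supernaturalDegree E.1.base E.1.top) ∧
      ∀ E ∈ A, ∀ h : E.base ≤ F,
        ¬ Disjoint (IntermediateField.extendScalars h) E.top := by
  have : IsAlgClosed Ω := IsAlgClosure.isAlgClosed k
  have : Algebra.IsAlgebraic k Ω := IsAlgClosure.isAlgebraic
  have : Normal k Ω := IsAlgClosure.normal k Ω
  have : Countable Ω := Set.countable_univ_iff.1
    ((Algebraic.countable k Ω).mono fun x _ ↦ Algebra.IsAlgebraic.isAlgebraic x)
  obtain ⟨P, hP, hmeets, hspec⟩ := Approx.exists_generic hk hA hvast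
  have hmono : Monotone fun i ↦ (P i).field := fun i j hij ↦ Approx.field_mono (hP hij)
  refine ⟨⨆ i, (P i).field, inferInstance, Approx.isHilbertian_iSup hk hP hspec,
    Approx.supernaturalDegree_iSup_dvd hP, fun E hE h hdisj ↦ ?_⟩
  have := hfin E hE
  obtain ⟨n, hn⟩ := exists_le_of_finiteDimensional_of_le_iSup hmono h
  obtain ⟨m, hm⟩ := hmeets ⟨E, hE⟩
  -- The base is finite over `k`, hence contained in some stage, which rules out the first
  -- alternative.
  obtain hm | ⟨a, haF, haL, haB⟩ := hm
  · exact hm (P (max m n)) (hP (le_max_left m n)) (hn.trans (hmono (le_max_right m n)))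
  · have haF' : a ∈ extendScalars h := le_iSup (fun i ↦ (P i).field) m haF
    have hbot : a ∈ (⊥ : IntermediateField E.base Ω) := hdisj.le_bot ⟨haF', haL⟩
    obtain ⟨b, rfl⟩ := mem_bot.1 hbot
    exact haB b.2
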